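/- A sign pattern of degree $d$ is a sequence of $d+1$ signs $+$ or $-$ beginning with $+$. A monic real polynomial $P=x^d+a_{d-1}x^{d-1}+\cdots+a_0$ with all $a_j\neq 0$ defines the sign pattern $(+,\operatorname{sgn}(a_{d-1}),\ldots,\operatorname{sgn}(a_0))$. A sign pattern is realizable with the pair $(pos,neg)$ if some monic real polynomial defining it has exactly $pos$ positive and exactly $neg$ negative roots, all its real roots being distinct (simple). For integers $m,n,q\geq 1$ let $\Sigma_{m,n,q}$ be the sign pattern consisting of $m$ pluses followed by $n$ minuses followed by $q$ pluses; its degree is $d=m+n+q-1$. (1) If $n=1$ and $d\geq 2$, or $n=2$ and $d\geq 3$, then every sign pattern $\Sigma_{m,n,q}$ is realizable with the pair $(0,d-2)$. (2) If $n=3$ and $d\geq 5$, then every sign pattern $\Sigma_{m,3,q}$ is realizable with the pair $(0,d-2)$. For $d=4$, the sign pattern $\Sigma_{1,3,1}$ is not realizable with the pair $(0,2)$. (3) The sign pattern $\Sigma_{m,4,q}$ is realizable with the pair $(0,d-2)$ if $m\geq 3$, $q\geq 3$ and $d\geq 10$, or if $m=2$ and $q\geq 6$ (hence $d\geq 11$).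 (4) For $m=1$, $n\geq 4$ and every $q\geq 1$, the sign pattern $\Sigma_{1,n,q}$ is not realizable with the pair $(0,d-2)$. -/

import Mathlib

open Polynomial

/-- The sign pattern `Σ_{m,n,q}`: `m` pluses, then `n` minuses, then `q` pluses. A sign pattern is
a list of signs `1`, `-1`, beginning with the sign of the leading coefficient. -/
def sigmaPattern (m n q : ℕ) : List SignType :=
  List.replicate m 1 ++ List.replicate n (-1) ++ List.replicate q 1

/-- The real polynomial `P` defines the sign pattern `σ`: it is monic, and the list of the signs of
its coefficients, from the leading one down to the constant one, is `σ` (so that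
`P.natDegree + 1 = σ.length`). -/
def DefinesSP (P : ℝ[X]) (σ : List SignType) : Prop :=
  P.Monic ∧ P.coeffList.map SignType.sign = σ

/-- The sign pattern `σ` is realizable with the pair `(pos, neg)`: some polynomial defining `σ` has
exactly `pos` positive and exactly `neg` negative roots, and its real roots are all distinct.
`P.roots` is the multiset of the real roots, each repeated according to its multiplicity. -/
def Realizable (σ : List SignType) (pos neg : ℕ) : Prop :=
  ∃ P : ℝ[X], DefinesSP P σ ∧ P.roots.Nodup ∧
    (P.roots.filter (fun x => 0 < x)).card = pos ∧
    (P.roots.filter (fun x => x < 0)).card = neg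

open Filter Topology

/-! Realizability: if `P` realizes a pattern, so does `P * (X + t)` with one more plus. For small `t
> 0` the plus is added at the end, for large `t` at the front, and each time one negative root is
gained. So `d - 2` is matched throughout (`Realizable.mono`), and finitely many explicit polynomials
suffice.

Obstruction: a polynomial with pair `(0, d - 2)` is a product of factors with negative roots and a
quadratic without real roots. Reversing it gives `T * (1 + β X + γ X ^ 2)`, where `T` has the
elementary symmetric functions `e_j` of positive numbers as coefficients, and `β ^ 2 < 4 γ`. For `m
= 1` the second sign forces `-β > e₁`, hence `γ` is large. Inequalities among the `e_j` then make
coefficient 4 (coefficient 3 for `Σ_{1,3,1}`) nonnegative, though the pattern wants it negative. -/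

/-- Membership in `Σ_{m,n,q}` in terms of the signs of the individual coefficients. -/
theorem definesSP_sigmaPattern_iff {P : ℝ[X]} {m n q : ℕ} :
    DefinesSP P (sigmaPattern m n q) ↔ P.Monic ∧ P.natDegree + 1 = m + n + q ∧
      (∀ i < q, 0 < P.coeff i) ∧ (∀ i, q ≤ i → i < q + n → P.coeff i < 0) ∧
      ∀ i, q + n ≤ i → i < q + n + m → 0 < P.coeff i := by
  unfold DefinesSP
  refine and_congr_right fun hP => ?_
  have hdeg : P.degree.succ = P.natDegree + 1 := by
    rw [Polynomial.degree_eq_natDegree hP.ne_zero]; rfl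
  have hcoe : P.coeffList = (List.range (P.natDegree + 1)).reverse.map P.coeff := by
    rw [coeffList, hdeg]
  have hlen : (sigmaPattern m n q).length = m + n + q := by simp [sigmaPattern, add_assoc]
  rw [hcoe]
  constructor
  · intro h
    have hl : P.natDegree + 1 = m + n + q := by
      have := congrArg List.length h
      rw [hlen] at this
      simpa using this
    have key : ∀ i (hi : i < P.natDegree + 1), SignType.sign (P.coeff i) =
        (sigmaPattern m n q)[P.natDegree - i]'(by omega) := by
      intro i hi
      have := List.getElem_of_eq h (i := P.natDegree - i) (by simp)
      rw [← this]
      simp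
      congr 2
      omega
    refine ⟨hl, fun i hi => ?_, fun i hi hi' => ?_, fun i hi hi' => ?_⟩
    · have := key i (by omega)
      rw [← sign_eq_one_iff, this]
      simp only [sigmaPattern, List.getElem_append, List.getElem_replicate, List.length_append,
        List.length_replicate]
      grind
    · have := key i (by omega)
      rw [← sign_eq_neg_one_iff, this]
      simp only [sigmaPattern, List.getElem_append, List.getElem_replicate, List.length_append,
        List.length_replicate]
      grind
    · have := key i (by omega)
      rw [← sign_eq_one_iff, this]
      simp only [sigmaPattern, List.getElem_append, List.getElem_replicate, List.length_append,
        List.length_replicate]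
      grind
  · rintro ⟨hl, h1, h2, h3⟩
    refine List.ext_getElem (by rw [hlen]; simpa using hl) fun i hi hi' => ?_
    have hi2 : i < m + n + q := by omega
    simp only [List.map_map, List.getElem_map, List.getElem_reverse, List.getElem_range,
      List.length_range, Function.comp]
    simp only [sigmaPattern, List.getElem_append, List.getElem_replicate, List.length_append,
      List.length_replicate]
    split_ifs with c1 c2
    · exact sign_eq_one_iff.2 (h3 _ (by omega) (by omega))
    · exact sign_eq_neg_one_iff.2 (h2 _ (by omega) (by omega))
    · exact sign_eq_one_iff.2 (h1 _ (by omega))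

/-! ### Lengthening a block of pluses by one negative root -/

theorem coeff_mul_X_add_C_succ (P : ℝ[X]) (t : ℝ) (i : ℕ) :
    (P * (X + C t)).coeff (i + 1) = P.coeff i + P.coeff (i + 1) * t := by
  simp [mul_add]

/-- Multiplying by `X + t`, where `t > 0` and `-t` is not a root, adds one negative root. -/
theorem realizable_of_mul_X_add_C {P : ℝ[X]} {n k m' q' : ℕ} {t : ℝ}
    (hP : P.Monic) (hnd : P.roots.Nodup) (hpos : (P.roots.filter (fun x => 0 < x)).card = 0)
    (hneg : (P.roots.filter (fun x => x < 0)).card = k) (ht : 0 < t) (hroot : P.eval (-t) ≠ 0)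
    (hsp : DefinesSP (P * (X + C t)) (sigmaPattern m' n q')) :
    Realizable (sigmaPattern m' n q') 0 (k + 1) := by
  have hne : P * (X + C t) ≠ 0 := (hP.mul (monic_X_add_C t)).ne_zero
  have hr : (P * (X + C t)).roots = -t ::ₘ P.roots := by
    rw [roots_mul hne, roots_X_add_C, add_comm, Multiset.singleton_add]
  refine ⟨_, hsp, ?_, ?_, ?_⟩
  · rw [hr, Multiset.nodup_cons]
    exact ⟨fun h => hroot (isRoot_of_mem_roots h), hnd⟩
  · rw [hr, Multiset.filter_cons_of_neg _ (by simp [ht.le]), hpos]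
  · rw [hr, Multiset.filter_cons_of_pos _ (by simpa using ht), Multiset.card_cons, hneg]

/-- A plus can be appended at the end of the pattern at the cost of a small negative root. -/
theorem Realizable.succ_right {m n q k : ℕ} (hq : 1 ≤ q)
    (h : Realizable (sigmaPattern m n q) 0 k) : Realizable (sigmaPattern m n (q + 1)) 0 (k + 1) := by
  obtain ⟨P, hP, hnd, hpos, hneg⟩ := h
  obtain ⟨hm, hd, h1, h2, h3⟩ := definesSP_sigmaPattern_iff.1 hP
  have hc (i : ℕ) : Tendsto (fun t : ℝ => P.coeff i + P.coeff (i + 1) * t) (𝓝[>] 0)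
      (𝓝 (P.coeff i)) := by
    have : ContinuousAt (fun t : ℝ => P.coeff i + P.coeff (i + 1) * t) 0 := by fun_prop
    simpa using this.tendsto.mono_left nhdsWithin_le_nhds
  have e1 : ∀ᶠ t : ℝ in 𝓝[>] 0, ∀ i ∈ Finset.range q, 0 < P.coeff i + P.coeff (i + 1) * t :=
    (Filter.eventually_all_finset _).2 fun i hi =>
      (hc i).eventually_const_lt (h1 i (Finset.mem_range.1 hi))
  have e2 : ∀ᶠ t : ℝ in 𝓝[>] 0, ∀ i ∈ Finset.Ico q (q + n),
      P.coeff i + P.coeff (i + 1) * t < 0 :=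
    (Filter.eventually_all_finset _).2 fun i hi =>
      (hc i).eventually_lt_const (h2 i (Finset.mem_Ico.1 hi).1 (Finset.mem_Ico.1 hi).2)
  have e3 : ∀ᶠ t : ℝ in 𝓝[>] 0, ∀ i ∈ Finset.Ico (q + n) (q + n + m),
      0 < P.coeff i + P.coeff (i + 1) * t :=
    (Filter.eventually_all_finset _).2 fun i hi =>
      (hc i).eventually_const_lt (h3 i (Finset.mem_Ico.1 hi).1 (Finset.mem_Ico.1 hi).2)
  -- Near 0 the value of `P` stays close to its positive constant term, so `-t` is a new root.
  have e4 : ∀ᶠ t : ℝ in 𝓝[>] 0, 0 < P.eval (-t) := by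
    have : ContinuousAt (fun t : ℝ => P.eval (-t)) 0 :=
      (P.continuous.comp continuous_neg).continuousAt
    refine (this.tendsto.mono_left nhdsWithin_le_nhds).eventually_const_lt ?_
    rw [neg_zero, ← coeff_zero_eq_eval_zero]
    exact h1 0 hq
  obtain ⟨t, f1, f2, f3, f4, ht⟩ :=
    (e1.and (e2.and (e3.and (e4.and self_mem_nhdsWithin)))).exists
  have ht : 0 < t := ht
  refine realizable_of_mul_X_add_C hm hnd hpos hneg ht f4.ne'
    (definesSP_sigmaPattern_iff.2 ⟨hm.mul (monic_X_add_C t), ?_, ?_, ?_, ?_⟩)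
  · rw [hm.natDegree_mul (monic_X_add_C t), natDegree_X_add_C]; omega
  · rintro (_ | i) hi
    · simpa using mul_pos (h1 0 hq) ht
    · rw [coeff_mul_X_add_C_succ]
      exact f1 i (Finset.mem_range.2 (by omega))
  · rintro (_ | i) hi hi'
    · omega
    · rw [coeff_mul_X_add_C_succ]
      exact f2 i (Finset.mem_Ico.2 (by omega))
  · rintro (_ | i) hi hi'
    · omega
    · rw [coeff_mul_X_add_C_succ]
      exact f3 i (Finset.mem_Ico.2 (by omega))

/-- A plus can be prepended to the pattern at the cost of a large negative root. -/
theorem Realizable.succ_left {m n q k : ℕ} (hm : 1 ≤ m) (hq : 1 ≤ q)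
    (h : Realizable (sigmaPattern m n q) 0 k) : Realizable (sigmaPattern (m + 1) n q) 0 (k + 1) := by
  obtain ⟨P, hP, hnd, hpos, hneg⟩ := h
  obtain ⟨hmon, hd, h1, h2, h3⟩ := definesSP_sigmaPattern_iff.1 hP
  -- For large `t` coefficient `i + 1` of the product takes the sign of `P.coeff (i + 1)`.
  have e1 : ∀ᶠ t : ℝ in atTop, ∀ i ∈ Finset.Ico 0 (q + n + m), 0 < P.coeff (i + 1) →
      0 < P.coeff i + P.coeff (i + 1) * t :=
    (Filter.eventually_all_finset _).2 fun i _ => by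
      by_cases hi : 0 < P.coeff (i + 1)
      · filter_upwards [(tendsto_atTop_add_const_left _ (P.coeff i)
          (tendsto_id.const_mul_atTop hi)).eventually_gt_atTop 0] with t ht _ using ht
      · simp [hi]
  have e2 : ∀ᶠ t : ℝ in atTop, ∀ i ∈ Finset.Ico 0 (q + n + m), P.coeff (i + 1) < 0 →
      P.coeff i + P.coeff (i + 1) * t < 0 :=
    (Filter.eventually_all_finset _).2 fun i _ => by
      by_cases hi : P.coeff (i + 1) < 0
      · filter_upwards [(tendsto_atBot_add_const_left _ (P.coeff i)
          (tendsto_id.const_mul_atTop_of_neg hi)).eventually_lt_atBot 0] with t ht _ using ht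
      · simp [hi]
  have e3 : ∀ᶠ t : ℝ in atTop, ∀ r ∈ P.roots.toFinset, -t < r :=
    (Filter.eventually_all_finset _).2 fun r _ => by
      filter_upwards [eventually_gt_atTop (-r)] with t ht
      linarith
  obtain ⟨t, f1, f2, f3, ht⟩ := (e1.and (e2.and (e3.and (eventually_gt_atTop (0 : ℝ))))).exists
  have hroot : P.eval (-t) ≠ 0 := fun h0 =>
    lt_irrefl _ (f3 (-t) (by simpa [hmon.ne_zero] using h0))
  refine realizable_of_mul_X_add_C hmon hnd hpos hneg ht hroot
    (definesSP_sigmaPattern_iff.2 ⟨hmon.mul (monic_X_add_C t), ?_, ?_, ?_, ?_⟩)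
  · rw [hmon.natDegree_mul (monic_X_add_C t), natDegree_X_add_C]; omega
  · rintro (_ | i) hi
    · simpa using mul_pos (h1 0 hq) ht
    · rw [coeff_mul_X_add_C_succ]
      exact f1 i (Finset.mem_Ico.2 (by omega)) (h1 _ hi)
  · rintro (_ | i) hi hi'
    · omega
    · rw [coeff_mul_X_add_C_succ]
      exact f2 i (Finset.mem_Ico.2 (by omega)) (h2 _ hi hi')
  · rintro (_ | i) hi hi'
    · omega
    · rw [coeff_mul_X_add_C_succ]
      -- The second case is the new leading coefficient, which is that of `P` and does not depend on
      -- `t`.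
      rcases Nat.lt_or_ge (i + 1) (q + n + m) with h | h
      · exact f1 i (Finset.mem_Ico.2 (by omega)) (h3 _ hi h)
      · rw [coeff_eq_zero_of_natDegree_lt (by omega : P.natDegree < i + 1), zero_mul, add_zero]
        exact h3 i (by omega) (by omega)

theorem Realizable.mono {m n q k m' q' : ℕ} (hm : 1 ≤ m) (hq : 1 ≤ q)
    (h : Realizable (sigmaPattern m n q) 0 k) (hm' : m ≤ m') (hq' : q ≤ q') {k' : ℕ}
    (hk : k + m' + q' = k' + m + q) : Realizable (sigmaPattern m' n q') 0 k' := by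
  obtain ⟨a, rfl⟩ := Nat.exists_eq_add_of_le hm'
  obtain ⟨b, rfl⟩ := Nat.exists_eq_add_of_le hq'
  obtain rfl : k' = k + a + b := by omega
  clear hk hm' hq'
  induction b with
  | succ b ih => exact Realizable.succ_right (Nat.le_add_right_of_le hq) ih
  | zero =>
    induction a with
    | zero => exact h
    | succ a ih => exact Realizable.succ_left (Nat.le_add_right_of_le hm) hq ih

/-! ### Explicit polynomials for the minimal patterns -/

/-- The polynomial with the given list of coefficients, from the constant one upwards. -/
noncomputable def ofCoeffs (l : List ℝ) : ℝ[X] :=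
  l.foldr (fun a p => C a + X * p) 0

theorem coeff_ofCoeffs (l : List ℝ) (i : ℕ) : (ofCoeffs l).coeff i = l.getD i 0 := by
  induction l generalizing i with
  | nil => simp [ofCoeffs]
  | cons a l ih =>
    have : ofCoeffs (a :: l) = C a + X * ofCoeffs l := rfl
    rw [this]
    cases i with
    | zero => simp
    | succ i => simp [ih]

/-- A product of distinct factors `X + r` with `r > 0` and an irreducible quadratic factor realizes
the pattern given by its coefficients. -/
theorem realizable_of_coeffs {m n q k : ℕ} {b c : ℝ} (rs : List ℝ) (l : List ℝ)
    (hrs : ∀ r ∈ rs, 0 < r) (hnd : rs.Nodup) (hk : rs.length = k) (hd : k + 3 = m + n + q)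
    (hbc : b ^ 2 < 4 * c)
    (hl : (rs.map fun r => X + C r).prod * (X ^ 2 + C b * X + C c) = ofCoeffs l)
    (h1 : ∀ i < q, 0 < l.getD i 0) (h2 : ∀ i, q ≤ i → i < q + n → l.getD i 0 < 0)
    (h3 : ∀ i, q + n ≤ i → i < q + n + m → 0 < l.getD i 0) :
    Realizable (sigmaPattern m n q) 0 k := by
  have hQ : (X ^ 2 + C b * X + C c : ℝ[X]).Monic := by monicity!
  have hQd : (X ^ 2 + C b * X + C c : ℝ[X]).natDegree = 2 := by compute_degree!
  have hQr : (X ^ 2 + C b * X + C c : ℝ[X]).roots = 0 := by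
    refine Multiset.eq_zero_of_forall_notMem fun x hx => ?_
    have := isRoot_of_mem_roots hx
    simp only [IsRoot, eval_add, eval_pow, eval_X, eval_mul, eval_C] at this
    nlinarith [sq_nonneg (2 * x + b)]
  have hRe : (rs.map fun r => X + C r).prod =
      ((Multiset.ofList (rs.map Neg.neg)).map fun a => X - C a).prod := by
    simp [Function.comp_def]
  have hR : (rs.map fun r => X + C r).prod.Monic := by
    rw [hRe]; exact monic_multiset_prod_of_monic _ _ fun a _ => monic_X_sub_C a
  have hRd : (rs.map fun r => X + C r).prod.natDegree = k := by
    rw [hRe, natDegree_multiset_prod_X_sub_C_eq_card]; simpa using hk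
  have hroots : ((rs.map fun r => X + C r).prod * (X ^ 2 + C b * X + C c)).roots =
      Multiset.ofList (rs.map Neg.neg) := by
    rw [roots_mul (hR.mul hQ).ne_zero, hQr, add_zero, hRe, roots_multiset_prod_X_sub_C]
  refine ⟨_, definesSP_sigmaPattern_iff.2 ⟨hR.mul hQ, ?_, ?_, ?_, ?_⟩, ?_, ?_, ?_⟩
  · rw [hR.natDegree_mul hQ, hRd, hQd]; omega
  · simpa only [hl, coeff_ofCoeffs] using h1
  · simpa only [hl, coeff_ofCoeffs] using h2
  · simpa only [hl, coeff_ofCoeffs] using h3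
  · rw [hroots]
    exact Multiset.coe_nodup.2 (hnd.map neg_injective)
  · rw [hroots, Multiset.card_eq_zero, Multiset.filter_eq_nil]
    intro a ha
    obtain ⟨r, hr, rfl⟩ := List.mem_map.1 (Multiset.mem_coe.1 ha)
    have := hrs r hr
    linarith
  · rw [hroots, Multiset.filter_eq_self.2]
    · simpa using hk
    intro a ha
    obtain ⟨r, hr, rfl⟩ := List.mem_map.1 (Multiset.mem_coe.1 ha)
    have := hrs r hr
    linarith

theorem realizable_sigmaPattern_1_1_1 : Realizable (sigmaPattern 1 1 1) 0 0 := by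
  refine realizable_of_coeffs (b := -1) (c := 1) [] [1, -1, 1]
    ?_ ?_ rfl rfl (by norm_num) ?_ ?_ ?_ ?_
  · simp
  · simp
  · simp only [List.map_nil, List.prod_nil, ofCoeffs, List.foldr_cons, List.foldr_nil, map_neg,
      map_one]
    ring
  all_goals
    intros
    interval_cases ‹ℕ›
    norm_num

theorem realizable_sigmaPattern_1_2_1 : Realizable (sigmaPattern 1 2 1) 0 1 := by
  refine realizable_of_coeffs (b := -19) (c := 100) [10]
    [1000, -90, -9, 1]
    ?_ ?_ rfl rfl (by norm_num) ?_ ?_ ?_ ?_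
  · simp
  · simp
  · simp only [List.map_cons, List.map_nil, List.prod_cons, List.prod_nil, ofCoeffs,
      List.foldr_cons, List.foldr_nil, map_neg, map_ofNat, map_one]
    ring
  all_goals
    intros
    interval_cases ‹ℕ› <;> norm_num

theorem realizable_sigmaPattern_1_3_2 : Realizable (sigmaPattern 1 3 2) 0 3 := by
  refine realizable_of_coeffs (b := -15) (c := 57) [3, 5, 6]
    [5130, 2241, -57, -90, -1, 1]
    ?_ ?_ rfl rfl (by norm_num) ?_ ?_ ?_ ?_
  · simp
  · simp
  · simp only [List.map_cons, List.map_nil, List.prod_cons, List.prod_nil, ofCoeffs,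
      List.foldr_cons, List.foldr_nil, map_neg, map_ofNat, map_one]
    ring
  all_goals
    intros
    interval_cases ‹ℕ› <;> norm_num

theorem realizable_sigmaPattern_2_3_1 : Realizable (sigmaPattern 2 3 1) 0 3 := by
  refine realizable_of_coeffs (b := -9) (c := 21) [6, 7, 10]
    [8820, -168, -645, -14, 14, 1]
    ?_ ?_ rfl rfl (by norm_num) ?_ ?_ ?_ ?_
  · simp
  · simp
  · simp only [List.map_cons, List.map_nil, List.prod_cons, List.prod_nil, ofCoeffs,
      List.foldr_cons, List.foldr_nil, map_neg, map_ofNat, map_one]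
    ring
  all_goals
    intros
    interval_cases ‹ℕ› <;> norm_num

theorem realizable_sigmaPattern_3_4_4 : Realizable (sigmaPattern 3 4 4) 0 8 := by
  refine realizable_of_coeffs (b := -25) (c := 157) [4, 5, 7, 10, 13, 14, 17, 19]
    [12921162800, 10252015340, 3015499356, 360638825, -112132, -4189182, -344339, -23, 1290, 64, 1]
    ?_ ?_ rfl rfl (by norm_num) ?_ ?_ ?_ ?_
  · simp
  · simp
  · simp only [List.map_cons, List.map_nil, List.prod_cons, List.prod_nil, ofCoeffs,
      List.foldr_cons, List.foldr_nil, map_neg, map_ofNat, map_one]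
    ring
  all_goals
    intros
    interval_cases ‹ℕ› <;> norm_num

theorem realizable_sigmaPattern_4_4_3 : Realizable (sigmaPattern 4 4 3) 0 8 := by
  refine realizable_of_coeffs (b := -20) (c := 101) [8, 9, 12, 13, 14, 15, 16, 19]
    [72422138880, 32703993792, 4615267320, -53726374, -78662091, -7195118, -3281, 39934, 2851, 86, 1]
    ?_ ?_ rfl rfl (by norm_num) ?_ ?_ ?_ ?_
  · simp
  · simp
  · simp only [List.map_cons, List.map_nil, List.prod_cons, List.prod_nil, ofCoeffs,
      List.foldr_cons, List.foldr_nil, map_neg, map_ofNat, map_one]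
    ring
  all_goals
    intros
    interval_cases ‹ℕ› <;> norm_num

theorem realizable_sigmaPattern_2_4_6 : Realizable (sigmaPattern 2 4 6) 0 9 := by
  refine realizable_of_coeffs (b := -51) (c := 651) [6, 7, 8, 9, 10, 13, 14, 15, 20]
    [1074868704000, 894626359200, 314699119560, 60000245268, 6480140610, 346363469, -110421, -1086009, -49320, -9, 51, 1]
    ?_ ?_ rfl rfl (by norm_num) ?_ ?_ ?_ ?_
  · simp
  · simp
  · simp only [List.map_cons, List.map_nil, List.prod_cons, List.prod_nil, ofCoeffs,
      List.foldr_cons, List.foldr_nil, map_neg, map_ofNat, map_one]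
    ring
  all_goals
    intros
    interval_cases ‹ℕ› <;> norm_num

/-! ### Obstruction from elementary symmetric functions -/

theorem reverse_X_sub_C (a : ℝ) : (X - C a).reverse = 1 + C (-a) * X := by
  rw [sub_eq_add_neg, ← C_neg, reverse_add_C, natDegree_X, pow_one, reverse, natDegree_X,
    reflect_one_X]

/-- The inequalities between the first coefficients `1, e₁, e₂, e₃, e₄` of a product of factors
`1 + a X` with `a > 0` (elementary symmetric functions of the numbers `a`). -/
theorem coeff_reverse_prod_X_sub_C (S : Multiset ℝ) (hS : ∀ a ∈ S, a < 0) :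
    let e := (S.map fun a => X - C a).prod.reverse.coeff
    e 0 = 1 ∧ 0 ≤ e 1 ∧ 0 ≤ e 2 ∧ 0 ≤ e 3 ∧ 0 ≤ e 4 ∧ 2 * e 2 ≤ e 1 ^ 2 ∧ 3 * e 3 ≤ e 1 * e 2 ∧
      e 1 * e 3 ≤ e 1 ^ 2 * e 2 / 4 + e 4 := by
  induction S using Multiset.induction with
  | empty => simp [← C_1, reverse_C, coeff_C, -map_one]
  | cons a S ih =>
    have ha : a < 0 := hS a (Multiset.mem_cons_self a S)
    have := ih fun b hb => hS b (Multiset.mem_cons_of_mem hb)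
    rw [Multiset.map_cons, Multiset.prod_cons, reverse_mul_of_domain, reverse_X_sub_C]
    generalize (S.map fun a => X - C a).prod.reverse = T at this
    obtain ⟨b, rfl⟩ : ∃ b, a = -b := ⟨-a, by ring⟩
    have hb : 0 < b := by linarith
    have h0 : ((1 + C b * X) * T).coeff 0 = T.coeff 0 := by simp [add_mul]
    have hs (i : ℕ) : ((1 + C b * X) * T).coeff (i + 1) = T.coeff (i + 1) + b * T.coeff i := by
      rw [add_mul, one_mul, mul_assoc, coeff_add, coeff_C_mul, coeff_X_mul]
    simp only [neg_neg, h0, hs 0, hs 1, hs 2, hs 3, zero_add, Nat.reduceAdd] at this ⊢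
    obtain ⟨t0, t1, t2, t3, t4, t5, t6, t7⟩ := this
    rw [t0]
    generalize T.coeff 1 = e₁ at *
    generalize T.coeff 2 = e₂ at *
    generalize T.coeff 3 = e₃ at *
    generalize T.coeff 4 = e₄ at *
    refine ⟨rfl, by positivity, by positivity, by positivity, by positivity, ?_, ?_, ?_⟩
    · nlinarith
    · nlinarith [mul_nonneg hb.le (sub_nonneg.2 t5), mul_nonneg (sq_nonneg b) t1]
    -- The slack grows by `b e₁ (e₁² - 2e₂) / 4 + b² ((e₁² - 2e₂) / 2 + e₂ / 4) + b³ e₁ / 4`; the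
    -- bound `2e₂ ≤ e₁²` is carried along for this induction.
    · nlinarith [mul_nonneg hb.le (mul_nonneg t1 (sub_nonneg.2 t5)),
        mul_nonneg (sq_nonneg b) (sub_nonneg.2 t5), mul_nonneg (pow_pos hb 3).le t1,
        mul_nonneg (sq_nonneg b) t2]

/-- A polynomial realizing `Σ_{m,n,q}` with the pair `(0, d - 2)` is a product of linear factors
with negative roots and of a quadratic factor without real roots. -/
theorem Realizable.exists_factorization {m n q k : ℕ} (hq : 1 ≤ q)
    (hk : k + 3 = m + n + q) (h : Realizable (sigmaPattern m n q) 0 k) :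
    ∃ (S : Multiset ℝ) (β γ : ℝ), S.card = k ∧ (∀ a ∈ S, a < 0) ∧ β ^ 2 < 4 * γ ∧
      ∀ j, m ≤ j → j < m + n →
        ((S.map fun a => X - C a).prod.reverse * (1 + C β * X + C γ * X ^ 2)).coeff j < 0 := by
  obtain ⟨P, hP, -, hpos, hneg⟩ := h
  obtain ⟨hmon, hd, h1, h2, -⟩ := definesSP_sigmaPattern_iff.1 hP
  have hS : ∀ a ∈ P.roots, a < 0 := by
    intro a ha
    rw [Multiset.card_eq_zero, Multiset.filter_eq_nil] at hpos
    refine lt_of_le_of_ne (not_lt.1 (hpos a ha)) ?_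
    rintro rfl
    have := isRoot_of_mem_roots ha
    rw [IsRoot, ← coeff_zero_eq_eval_zero] at this
    exact (h1 0 hq).ne' this
  rw [Multiset.filter_eq_self.2 hS] at hneg
  obtain ⟨Q, hQ, hQd, hQr⟩ := P.exists_prod_multiset_X_sub_C_mul
  have hQ2 : Q.natDegree = 2 := by omega
  have hQm : Q.Monic := (monic_multiset_prod_of_monic _ _ fun a _ =>
    monic_X_sub_C a).of_mul_monic_left (hQ.symm ▸ hmon)
  have hQ2' : Q.coeff 2 = 1 := by rw [← hQ2]; exact hQm
  have hQe : Q = X ^ 2 + C (Q.coeff 1) * X + C (Q.coeff 0) := by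
    conv_lhs => rw [Q.as_sum_range_C_mul_X_pow, hQ2]
    simp [Finset.sum_range_succ, hQ2']
    ring
  have hQrev : Q.reverse = 1 + C (Q.coeff 1) * X + C (Q.coeff 0) * X ^ 2 := by
    ext i
    rw [coeff_reverse, hQ2]
    rcases i with _ | _ | _ | i
    · simp [revAt_le, hQ2']
    · simp [revAt_le, coeff_one]
    · simp [revAt_le, coeff_one]
    · rw [revAt_eq_self_of_lt (by omega), coeff_eq_zero_of_natDegree_lt (by omega)]
      simp [coeff_one]
  refine ⟨P.roots, Q.coeff 1, Q.coeff 0, hneg, hS, ?_, fun j hj hj' => ?_⟩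
  · by_contra! hdisc
    have hr : Q.eval ((-Q.coeff 1 + √(Q.coeff 1 ^ 2 - 4 * Q.coeff 0)) / 2) = 0 := by
      have := Real.sq_sqrt (sub_nonneg.2 hdisc)
      rw [hQe]
      simp only [eval_add, eval_pow, eval_X, eval_mul, eval_C]
      rw [← hQe]
      nlinarith
    have := (mem_roots hQm.ne_zero).2 hr
    simp [hQr] at this
  · rw [← hQrev, ← reverse_mul_of_domain, hQ, coeff_reverse, revAt_le (by omega)]
    exact h2 _ (by omega) (by omega)

theorem coeff_mul_one_add_quadratic (T : ℝ[X]) (β γ : ℝ) (j : ℕ) :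
    (T * (1 + C β * X + C γ * X ^ 2)).coeff (j + 2) =
      T.coeff (j + 2) + β * T.coeff (j + 1) + γ * T.coeff j := by
  rw [show T * (1 + C β * X + C γ * X ^ 2) = T + C β * (T * X) + C γ * (T * X ^ 2) by ring]
  rw [coeff_add, coeff_add, coeff_C_mul, coeff_C_mul, coeff_mul_X, coeff_mul_X_pow]

theorem coeff_one_mul_one_add_quadratic (T : ℝ[X]) (β γ : ℝ) :
    (T * (1 + C β * X + C γ * X ^ 2)).coeff 1 = T.coeff 1 + β * T.coeff 0 := by
  rw [show T * (1 + C β * X + C γ * X ^ 2) = T + C β * (T * X) + C γ * (T * X) * X by ring]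
  rw [coeff_add, coeff_add, coeff_C_mul, coeff_mul_X, coeff_mul_X, coeff_C_mul, mul_coeff_zero]
  simp

theorem not_realizable_sigmaPattern_one {n q k : ℕ} (hn : 4 ≤ n) (hq : 1 ≤ q)
    (hk : k + 3 = 1 + n + q) : ¬ Realizable (sigmaPattern 1 n q) 0 k := by
  intro h
  obtain ⟨S, β, γ, -, hS, hdisc, hneg⟩ := h.exists_factorization hq hk
  have := coeff_reverse_prod_X_sub_C S hS
  have p1 := hneg 1 le_rfl (by omega)
  have p4 := hneg 4 (by omega) (by omega)
  rw [coeff_one_mul_one_add_quadratic] at p1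
  rw [coeff_mul_one_add_quadratic] at p4
  generalize (S.map fun a => X - C a).prod.reverse = T at *
  obtain ⟨t0, t1, t2, t3, -, -, t6, t7⟩ := this
  rw [t0] at p1
  norm_num at p4
  generalize T.coeff 1 = e₁ at *
  generalize T.coeff 2 = e₂ at *
  generalize T.coeff 3 = e₃ at *
  generalize T.coeff 4 = e₄ at *
  obtain ⟨s, rfl⟩ : ∃ s, β = -(e₁ + s) := ⟨-β - e₁, by ring⟩
  have hs : 0 < s := by linarith
  -- As `γ ≥ (e₁ + s)² / 4`, coefficient 4 is at least `(e₄ - e₁e₃ + e₁²e₂ / 4) + s (e₁e₂ / 2 - e₃)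
  -- + s² e₂ / 4`, where every term is nonnegative.
  nlinarith [mul_nonneg t2 (sub_nonneg.2 hdisc.le), mul_nonneg hs.le (sub_nonneg.2 t6),
    mul_nonneg hs.le (mul_nonneg t1 t2), mul_nonneg (sq_nonneg s) t2]

theorem not_realizable_sigmaPattern_1_3_1 : ¬ Realizable (sigmaPattern 1 3 1) 0 2 := by
  intro h
  obtain ⟨S, β, γ, hcard, hS, hdisc, hneg⟩ := h.exists_factorization (n := 3) le_rfl rfl
  obtain ⟨x, y, rfl⟩ := Multiset.card_eq_two.1 hcard
  have hx : x < 0 := hS x (by simp)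
  have hy : y < 0 := hS y (by simp)
  have hT : (({x, y} : Multiset ℝ).map fun a => X - C a).prod.reverse =
      1 + C (-(x + y)) * X + C (x * y) * X ^ 2 := by
    simp [reverse_mul_of_domain, reverse_X_sub_C]
    ring
  rw [hT] at hneg
  have p1 := hneg 1 le_rfl (by omega)
  have p3 := hneg 3 (by omega) (by omega)
  rw [coeff_one_mul_one_add_quadratic] at p1
  rw [coeff_mul_one_add_quadratic] at p3
  simp only [coeff_add, coeff_C_mul, coeff_X, coeff_X_pow, coeff_one] at p1 p3
  norm_num at p1 p3
  obtain ⟨s, rfl⟩ : ∃ s, β = x + y - s := ⟨x + y - β, by ring⟩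
  have hs : 0 < s := by linarith
  have hb : 0 < -(x + y) + s := by linarith
  -- With `u = -(x + y)` and `-β = u + s`, the bounds on `γ` give `(u + s) u < 4xy`, against `4xy ≤
  -- u²`.
  have hγ : ((-(x + y) + s) ^ 2 / 4) * -(x + y) < γ * -(x + y) :=
    mul_lt_mul_of_pos_right (by nlinarith) (by linarith)
  have h4 : (-(x + y) + s) * ((-(x + y) + s) * -(x + y)) < (-(x + y) + s) * (4 * (x * y)) := by
    nlinarith
  have h5 := lt_of_mul_lt_mul_left h4 hb.le
  nlinarith [sq_nonneg (x - y), mul_pos hs (show 0 < -(x + y) by linarith)]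

/-! ### Assembly: every pattern in (1)–(3) dominates one of the explicit ones -/

theorem theorem1 :
    -- (1)
    ((∀ d m q : ℕ, 1 ≤ m → 1 ≤ q → m + 1 + q = d + 1 → 2 ≤ d →
        Realizable (sigmaPattern m 1 q) 0 (d - 2)) ∧
      (∀ d m q : ℕ, 1 ≤ m → 1 ≤ q → m + 2 + q = d + 1 → 3 ≤ d →
        Realizable (sigmaPattern m 2 q) 0 (d - 2))) ∧
    -- (2)
    ((∀ d m q : ℕ, 1 ≤ m → 1 ≤ q → m + 3 + q = d + 1 → 5 ≤ d →
        Realizable (sigmaPattern m 3 q) 0 (d - 2)) ∧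
      ¬ Realizable (sigmaPattern 1 3 1) 0 2) ∧
    -- (3)
    ((∀ d m q : ℕ, 3 ≤ m → 3 ≤ q → m + 4 + q = d + 1 → 10 ≤ d →
        Realizable (sigmaPattern m 4 q) 0 (d - 2)) ∧
      (∀ d q : ℕ, 6 ≤ q → 2 + 4 + q = d + 1 →
        Realizable (sigmaPattern 2 4 q) 0 (d - 2))) ∧
    -- (4)
    (∀ d n q : ℕ, 4 ≤ n → 1 ≤ q → 1 + n + q = d + 1 →
        ¬ Realizable (sigmaPattern 1 n q) 0 (d - 2)) := by
  refine ⟨⟨?_, ?_⟩, ⟨?_, not_realizable_sigmaPattern_1_3_1⟩, ⟨?_, ?_⟩, ?_⟩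
  · intro d m q hm hq h hd
    exact realizable_sigmaPattern_1_1_1.mono le_rfl le_rfl hm hq (by omega)
  · intro d m q hm hq h hd
    exact realizable_sigmaPattern_1_2_1.mono le_rfl le_rfl hm hq (by omega)
  · intro d m q hm hq h hd
    rcases Nat.lt_or_ge m 2 with h2 | h2
    · exact realizable_sigmaPattern_1_3_2.mono le_rfl (by omega) hm (by omega) (by omega)
    · exact realizable_sigmaPattern_2_3_1.mono (by omega) le_rfl h2 hq (by omega)
  · intro d m q hm hq h hd
    rcases Nat.lt_or_ge m 4 with h4 | h4
    · exact realizable_sigmaPattern_3_4_4.mono (by omega) (by omega) hm (by omega) (by omega)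
    · exact realizable_sigmaPattern_4_4_3.mono (by omega) (by omega) h4 hq (by omega)
  · intro d q hq h
    exact realizable_sigmaPattern_2_4_6.mono (by omega) (by omega) le_rfl hq (by omega)
  · intro d n q hn hq h
    exact not_realizable_sigmaPattern_one hn hq (by omega)
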